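/- **Setting.** Write $(\Delta F)(n)=F(n+1)-F(n)$ and $\Delta^{(\ell)}$ for the $\ell$-fold iterate of $\Delta$. Randomized online algorithms draw a random seed and produce each output from the seed and the inputs received so far; input sequences are fixed in advance (they do not depend on the seed), and the length of the input sequence is not known to the algorithm. *Discrete OCS.* Let $m\in\mathbb N$ and $F:\mathbb Z_{\ge 0}\to[0,1]$. An $m$-discrete OCS on a finite ground set $L$ is a randomized online algorithm that at each time step $j$ receives a multiset $A_j$ of $m$ elements of $L$ and irrevocably selects a winner from $A_j$. It is an $(F,m)$-discrete OCS if for every input sequence $(A_j)_j$, every $i\in L$ and all pairwise disjoint sets $S_1,\dots,S_k$ of consecutive time steps (each $S_\ell=\{a_\ell,a_\ell+1,\dots,b_\ell\}$ with $a_\ell<b_\ell$), the probability that $i$ never wins at a time step of $S_1\cup\dots\cup S_k$ is at most $\prod_{\ell=1}^k F(\mathrm{count}_i(S_\ell))$, where $\mathrm{count}_i(S)$ is the number of appearances of $i$, with multiplicity, in the multisets $A_j$, $j\in S$. *Edge-weighted online bipartite matching (free disposal).* A finite set $L$ of offline vertices is known in advance. Online vertices $j=1,\dots,T$ arrive one by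 one; on arrival of $j$ the weights $w_{ij}\ge 0$, $i\in L$, are revealed ($w_{ij}=0$ means that there is no edge), and $j$ must irrevocably be matched to a neighbour $i\in L$ or discarded. An offline vertex may be matched to several online vertices, but contributes only the largest weight of the edges matched to it (and $0$ if there are none); the total weight is the sum of these contributions. An algorithm is $\Gamma$-competitive if on every instance its expected total weight is at least $\Gamma$ times the optimal total weight in hindsight. **Theorem.** Let $m\in\mathbb N$ and let $F:\mathbb Z_{\ge 0}\to[0,1]$ be convex ($\Delta^{(2)}F\ge 0$) and log-concave ($F(k)F(k+2)\le F(k+1)^2$ for all $k$, no internal zeros), with $F(k)\to 0$ as $k\to\infty$, and suppose that for all $k_1,k_2\in\mathbb Z_{\ge 0}$ $$\Delta^{(3)}F(k_1)\,\Delta F(k_2)+\Delta F(k_1)\,\Delta^{(3)}F(k_2)\le 2\,\Delta^{(2)}F(k_1)\,\Delta^{(2)}F(k_2).$$ Let $$\Gamma:=1-\sum_{n=0}^\infty\frac{m^n}{(m+1)^{n+1}}F(n),$$ and suppose that (the denominator being nonzero) $$m\le\frac{-m\,\Delta F(0)-\Gamma}{\Gamma+(1-\Gamma)\,m\,\Delta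 F(0)}.$$ If there is an $(F,m)$-discrete OCS (on every finite ground set), then there is a $\Gamma$-competitive randomized algorithm for edge-weighted online bipartite matching with free disposal (for every finite set $L$ of offline vertices). -/

import Mathlib

open scoped NNReal
open MeasureTheory

/-- A randomized online algorithm with inputs in `X` and outputs in `Y`: the random seed `ω` is
drawn from a probability space, and the output at time `t` depends on `ω` and on the inputs
received at the times `0, …, t` only. -/
structure OnlineAlgorithm (X Y : Type) where
  Ω : Type
  [mΩ : MeasurableSpace Ω]
  μ : Measure Ω
  [isProb : IsProbabilityMeasure μ]
  act : (t : ℕ) → (Fin (t + 1) → X) → Ω → Y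
  measurable_act : ∀ (t : ℕ) (h : Fin (t + 1) → X) (y : Y), MeasurableSet {ω | act t h ω = y}

attribute [instance] OnlineAlgorithm.mΩ OnlineAlgorithm.isProb

/-- An `m`-discrete OCS on the ground set `L`: at each time step it receives a multiset of size `m`
and selects a single winner from it. -/
structure DiscreteOCS (L : Type) (m : ℕ) extends OnlineAlgorithm (Sym L m) L where
  act_mem : ∀ (t : ℕ) (h : Fin (t + 1) → Sym L m) (ω : Ω), act t h ω ∈ h (Fin.last t)

namespace DiscreteOCS

variable {L : Type} {m : ℕ}

/-- The winner at time `t` when the input sequence is `A`. -/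
def winner (O : DiscreteOCS L m) (A : ℕ → Sym L m) (t : ℕ) (ω : O.Ω) : L :=
  O.act t (fun s => A s) ω

/-- The number of appearances of `i` at the time steps `a, a + 1, …, b`, with multiplicity. -/
def count [DecidableEq L] (A : ℕ → Sym L m) (i : L) (a b : ℕ) : ℕ :=
  ∑ t ∈ Finset.Icc a b, (A t : Multiset L).count i

/-- The guarantee of an `(F, m)`-discrete OCS: for every input sequence, element `i`, and pairwise
disjoint sets `S ℓ = {a ℓ, …, b ℓ}` of consecutive time steps, `a ℓ < b ℓ`, the probability that `i`
never wins in their union is at most `∏ ℓ, F (count_i (S ℓ))`. -/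
def HasParameter [DecidableEq L] (O : DiscreteOCS L m) (F : ℕ → ℝ) : Prop :=
  ∀ (A : ℕ → Sym L m) (i : L) (k : ℕ) (a b : Fin k → ℕ),
    (∀ ℓ, a ℓ < b ℓ) →
    (∀ ℓ ℓ', ℓ ≠ ℓ' → Disjoint (Finset.Icc (a ℓ) (b ℓ)) (Finset.Icc (a ℓ') (b ℓ'))) →
    O.μ.real {ω | ∀ ℓ, ∀ t ∈ Finset.Icc (a ℓ) (b ℓ), O.winner A t ω ≠ i}
      ≤ ∏ ℓ, F (count A i (a ℓ) (b ℓ))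

end DiscreteOCS

/-- The total weight, under free disposal, of the assignment `σ` of the online vertices
`0, …, T - 1` to offline vertices (`none`: discarded): every offline vertex contributes the largest
weight among the online vertices assigned to it. `w j i` is the weight of the edge between the
offline vertex `i` and the online vertex `j`, and `0` if there is no such edge. -/
noncomputable def matchingWeight {L : Type} [Fintype L] [DecidableEq L] {T : ℕ}
    (w : Fin T → L → ℝ≥0) (σ : Fin T → Option L) : ℝ≥0 :=
  ∑ i, (Finset.univ.filter fun j => σ j = some i).sup fun j => w j i

/-- The optimal total weight in hindsight. -/
noncomputable def optimalWeight {L : Type} [Fintype L] [DecidableEq L] {T : ℕ}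
    (w : Fin T → L → ℝ≥0) : ℝ≥0 :=
  (Finset.univ : Finset (Fin T → Option L)).sup fun σ => matchingWeight w σ

/-- A randomized algorithm for edge-weighted online bipartite matching with offline vertices `L`.
The online vertex arriving at time `t` is presented by its vector of edge weights; it is
irrevocably matched to a neighbour or discarded (`none`). The number of online vertices is not
known to the algorithm. -/
structure OnlineMatchingAlgorithm (L : Type) extends OnlineAlgorithm (L → ℝ≥0) (Option L) where
  act_edge : ∀ (t : ℕ) (h : Fin (t + 1) → L → ℝ≥0) (ω : Ω) (i : L),
    act t h ω = some i → 0 < h (Fin.last t) i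

namespace OnlineMatchingAlgorithm

variable {L : Type}

/-- The assignment produced on the instance `w`. -/
def assignment (B : OnlineMatchingAlgorithm L) {T : ℕ} (w : Fin T → L → ℝ≥0) (ω : B.Ω) :
    Fin T → Option L :=
  fun j => B.act j (fun s => w (s.castLE j.isLt)) ω

/-- The expected total weight of the output is at least `Γ` times the optimum, on all instances. -/
def IsCompetitive [Fintype L] [DecidableEq L] (B : OnlineMatchingAlgorithm L) (Γ : ℝ) : Prop :=
  ∀ (T : ℕ) (w : Fin T → L → ℝ≥0),
    Γ * (optimalWeight w : ℝ) ≤ ∫ ω, (matchingWeight w (B.assignment w ω) : ℝ) ∂B.μ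

end OnlineMatchingAlgorithm

/-- Convexity of a sequence: its second discrete derivative is nonnegative. -/
def ConvexSeq (F : ℕ → ℝ) : Prop := ∀ k, 0 ≤ (fwdDiff 1)^[2] F k

/-- Log-concavity of a nonnegative sequence (no internal zeros). -/
def LogConcaveSeq (F : ℕ → ℝ) : Prop :=
  (∀ k, F k * F (k + 2) ≤ F (k + 1) ^ 2) ∧ ∀ i j k, i ≤ j → j ≤ k → F i ≠ 0 → F k ≠ 0 → F j ≠ 0

/-- `Γ = 1 - ∑ n, m ^ n / (m + 1) ^ (n + 1) * F n`. -/
noncomputable def competitiveRatio (m : ℕ) (F : ℕ → ℝ) : ℝ :=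
  1 - ∑' n : ℕ, (m : ℝ) ^ n / ((m : ℝ) + 1) ^ (n + 1) * F n

/-!
The algorithm chooses, for each arriving online vertex, a multiset of `m` offline vertices
deterministically, feeds it to the OCS and matches the online vertex to the winner. It is analysed
by online primal-dual.

Fix an offline vertex `i` and a weight threshold `x`. The rounds in which `i` appears with weight
less than `x` cut time into runs, and if `i` never wins a weight of at least `x`, then it wins in no
run; so this has probability at most `p * F n`, where `p` is the product of the values of `F` on the
closed runs and `n` is the number of appearances in the current run (`measureReal_le_runState`).
By the layer-cake formula, the integral of `1 - p * F n` over `x > 0` bounds the expected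
contribution of `i` from below (`primalVal_le_integral`).

The dual variable of `i` is the integral over `x > 0` of `Γ - p * c n`, where
`c n = ∑ k, (m / (m + 1)) ^ (k + 1) * (F (n + k) - F (n + k + 1))`. This `c` solves the recursion
`F n - F (n + 1) = c n - c (n + 1) + c n / m`, and `c 0 = Γ`. The vertex `i` offers to an online
vertex the amount `Γ * w - dualVar` by which dual feasibility of their edge fails, and the
algorithm accepts `m` times, one after the other, a largest current offer; the online vertex gets
their average as its dual variable. Dual variables of offline vertices only grow, so the dual
solution is feasible in the end (`dual_feasible`). At the thresholds `x ≤ w`, the recursion says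
that the primal gain of an appearance equals the dual increase. At the thresholds `x > w` the run
is closed; there is no primal gain, and the inequalities needed are `F n * Γ ≤ c n`, so that the
dual variable does not drop, and `c n - F n * Γ ≤ (Γ - c n) / m`, so that its rise is covered by the
negative part of the offer (`share_advance_le`). The former follows from log-concavity of `F`. The
latter is, for `n = 1`, equivalent to the upper bound on `m`, and passes on to all `n` since
`-ΔF` is log-concave, which is the third-order hypothesis on the diagonal `k₁ = k₂`
(`isResidual_residualSeq`). Weak duality (`mul_optimalWeight_le`) concludes.

The guarantee of an OCS is about intervals of at least two steps, so its input is interleaved with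
steps that consist of dummy elements only (`padded`). The dummy element may be picked by the greedy
rule, too, with offer `0`; this keeps the accepted offers nonnegative.
-/

/-! ### Log-concave sequences and the residual sequence -/

theorem mul_succ_le_of_logConcave {u : ℕ → ℝ} (h0 : ∀ k, 0 ≤ u k) (hanti : Antitone u)
    (hlc : ∀ k, u k * u (k + 2) ≤ u (k + 1) ^ 2) {k n : ℕ} (hkn : k ≤ n) :
    u (n + 1) * u k ≤ u (k + 1) * u n := by
  induction n, hkn using Nat.le_induction with
  | base => exact le_rfl
  | succ n _ ih =>
    rcases (h0 n).eq_or_lt with hn | hn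
    · have h2 : u (n + 2) = 0 := le_antisymm (hn ▸ hanti (by omega)) (h0 _)
      rw [show n + 1 + 1 = n + 2 from rfl, h2, zero_mul]
      exact mul_nonneg (h0 _) (h0 _)
    · refine le_of_mul_le_mul_left ?_ hn
      calc u n * (u (n + 2) * u k) = (u n * u (n + 2)) * u k := by ring
        _ ≤ u (n + 1) ^ 2 * u k := mul_le_mul_of_nonneg_right (hlc n) (h0 k)
        _ = u (n + 1) * (u (n + 1) * u k) := by ring
        _ ≤ u (n + 1) * (u (k + 1) * u n) := mul_le_mul_of_nonneg_left ih (h0 _)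
        _ = u n * (u (k + 1) * u (n + 1)) := by ring

/-- Antitone log-concave sequences are submultiplicative after normalization by the initial
term. -/
theorem add_mul_zero_le_of_logConcave {u : ℕ → ℝ} (h0 : ∀ k, 0 ≤ u k) (hanti : Antitone u)
    (hlc : ∀ k, u k * u (k + 2) ≤ u (k + 1) ^ 2) (n k : ℕ) :
    u (n + k) * u 0 ≤ u n * u k := by
  induction k with
  | zero => exact le_rfl
  | succ k ih =>
    rcases (h0 k).eq_or_lt with hk | hk
    · have h2 : u (n + (k + 1)) = 0 := le_antisymm (hk ▸ hanti (by omega)) (h0 _)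
      rw [h2, zero_mul]
      exact mul_nonneg (h0 _) (h0 _)
    · refine le_of_mul_le_mul_left ?_ hk
      have h1 := mul_succ_le_of_logConcave h0 hanti hlc (k := k) (n := n + k) (by omega)
      calc u k * (u (n + (k + 1)) * u 0) = (u (n + k + 1) * u k) * u 0 := by
            rw [← add_assoc]; ring
        _ ≤ (u (k + 1) * u (n + k)) * u 0 := mul_le_mul_of_nonneg_right h1 (h0 0)
        _ = u (k + 1) * (u (n + k) * u 0) := by ring
        _ ≤ u (k + 1) * (u n * u k) := mul_le_mul_of_nonneg_left ih (h0 _)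
        _ = u k * (u n * u (k + 1)) := by ring

/-- The part of the guarantee `Γ` that the dual variable of an offline vertex still lacks after `n`
appearances in a single run (unit weight): the discounted sum of the future decrements of `F`. -/
noncomputable def residualSeq (m : ℕ) (F : ℕ → ℝ) (n : ℕ) : ℝ :=
  ∑' k : ℕ, ((m : ℝ) / (m + 1)) ^ (k + 1) * (F (n + k) - F (n + k + 1))

/-- What the primal-dual analysis needs to know about a residual sequence `c`: `share` splits the
primal gain of an appearance between the two dual variables, while `cut_mono` and `cut_le` say
that closing a run never lowers the dual variable of the offline vertex and raises it by a factor
of at most `1 + 1 / m`. -/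
structure IsResidual (m : ℕ) (F : ℕ → ℝ) (Γ : ℝ) (c : ℕ → ℝ) : Prop where
  F_mem : ∀ n, F n ∈ Set.Icc (0 : ℝ) 1
  F_zero : F 0 = 1
  zero : c 0 = Γ
  nonneg : ∀ n, 0 ≤ c n
  anti : ∀ n, c (n + 1) ≤ c n
  share : ∀ n, F n - F (n + 1) = c n - c (n + 1) + c n / m
  cut_mono : ∀ n, F n * Γ ≤ c n
  cut_le : ∀ n, c n - F n * Γ ≤ (Γ - c n) / m

theorem isResidual_residualSeq {m : ℕ} (hm0 : m ≠ 0) {F : ℕ → ℝ}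
    (hF01 : ∀ k, F k ∈ Set.Icc (0 : ℝ) 1) (hF0 : F 0 = 1)
    (hconv : ConvexSeq F) (hlog : LogConcaveSeq F)
    (hlim : Filter.Tendsto F Filter.atTop (nhds 0))
    (hthird : ∀ k₁ k₂ : ℕ,
      (fwdDiff 1)^[3] F k₁ * fwdDiff 1 F k₂ + fwdDiff 1 F k₁ * (fwdDiff 1)^[3] F k₂
        ≤ 2 * ((fwdDiff 1)^[2] F k₁ * (fwdDiff 1)^[2] F k₂))
    {Γ : ℝ} (hΓ : Γ = competitiveRatio m F)
    (hm : (m : ℝ) ≤ (-(m : ℝ) * fwdDiff 1 F 0 - Γ) / (Γ + (1 - Γ) * ((m : ℝ) * fwdDiff 1 F 0))) :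
    IsResidual m F Γ (residualSeq m F) := by
  obtain ⟨f, hf⟩ : ∃ f : ℕ → ℝ, ∀ n, f n = F n - F (n + 1) := ⟨_, fun _ => rfl⟩
  have hmpos : (0 : ℝ) < m := by positivity
  obtain ⟨r, hr⟩ : ∃ r : ℝ, r = (m : ℝ) / (m + 1) := ⟨_, rfl⟩
  have hr0 : 0 < r := by rw [hr]; positivity
  have hr1 : r < 1 := by rw [hr, div_lt_one (by positivity)]; linarith
  -- `f = -ΔF` is antitone by convexity, and tends to `0`, hence is nonnegative
  have hfanti : Antitone f := by
    refine antitone_nat_of_succ_le fun n => ?_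
    have := hconv n
    simp only [Function.iterate_succ, Function.iterate_zero, Function.comp, id, fwdDiff] at this
    rw [hf, hf]; linarith
  have hflim : Filter.Tendsto f Filter.atTop (nhds 0) := by
    have h := hlim.sub (hlim.comp (Filter.tendsto_add_atTop_nat 1))
    rw [sub_zero] at h
    exact h.congr fun n => (hf n).symm
  have hf0 : ∀ n, 0 ≤ f n := fun n => hfanti.le_of_tendsto hflim n
  have hf1 : ∀ n, f n ≤ 1 := fun n => by
    rw [hf]; linarith [(hF01 n).2, (hF01 (n + 1)).1]
  have hFanti : Antitone F := antitone_nat_of_succ_le fun n => by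
    have := hf0 n; rw [hf] at this; linarith
  -- the third-order hypothesis on the diagonal is log-concavity of `f`
  have hflc : ∀ k, f k * f (k + 2) ≤ f (k + 1) ^ 2 := by
    intro k
    have := hthird k k
    simp only [Function.iterate_succ, Function.iterate_zero, Function.comp, id, fwdDiff] at this
    simp only [hf]
    nlinarith
  have hsumF : ∀ n, Summable fun k => r ^ k * F (n + k) := fun n =>
    (summable_geometric_of_lt_one hr0.le hr1).of_nonneg_of_le
      (fun k => mul_nonneg (by positivity) (hF01 _).1)
      (fun k => mul_le_of_le_one_right (by positivity) (hF01 _).2)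
  have hsumf : ∀ n, Summable fun k => r ^ (k + 1) * f (n + k) := fun n =>
    (summable_geometric_of_lt_one hr0.le hr1).of_nonneg_of_le
      (fun k => mul_nonneg (by positivity) (hf0 _))
      (fun k => (mul_le_of_le_one_right (by positivity) (hf1 _)).trans
        (pow_le_pow_of_le_one hr0.le hr1.le (by omega)))
  have hc : ∀ n, residualSeq m F n = ∑' k, r ^ (k + 1) * f (n + k) := fun n => by
    simp only [residualSeq, hf, hr]
  have hrec : ∀ n, residualSeq m F n = r * f n + r * residualSeq m F (n + 1) := by
    intro n
    rw [hc, (hsumf n).tsum_eq_zero_add, hc, ← tsum_mul_left]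
    simp only [zero_add, pow_one, add_zero]
    congr 1
    refine tsum_congr fun k => ?_
    rw [show n + (k + 1) = n + 1 + k by ring]; ring
  have hmr : r * (m + 1) = m := by rw [hr]; field_simp
  have hshare : ∀ n, f n = residualSeq m F n - residualSeq m F (n + 1) + residualSeq m F n / m := by
    intro n
    have h1 := hrec n
    field_simp
    have h2 : (residualSeq m F n) * (m + 1) = m * (f n + residualSeq m F (n + 1)) := by
      linear_combination (m + 1) * h1 + (f n + residualSeq m F (n + 1)) * hmr
    linarith
  -- summation by parts
  have hparts : ∀ n, residualSeq m F n = F n - (1 - r) * ∑' k, r ^ k * F (n + k) := by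
    intro n
    have h1 : ∑' k, r ^ (k + 1) * f (n + k)
        = r * (∑' k, r ^ k * F (n + k)) - ∑' k, r ^ (k + 1) * F (n + (k + 1)) := by
      rw [← tsum_mul_left, ← ((hsumF n).mul_left r).tsum_sub
        ((summable_nat_add_iff 1).mpr (hsumF n))]
      refine tsum_congr fun k => ?_
      rw [hf, ← add_assoc]; ring
    have h2 := (hsumF n).tsum_eq_zero_add
    simp only [pow_zero, one_mul, add_zero] at h2
    rw [hc, h1]; linarith
  have hzero : residualSeq m F 0 = Γ := by
    rw [hparts, hF0, hΓ, competitiveRatio, ← tsum_mul_left]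
    congr 1
    refine tsum_congr fun k => ?_
    have : 1 - r = 1 / ((m : ℝ) + 1) := by rw [hr]; field_simp; ring
    rw [this, hr, zero_add, div_pow, pow_succ]; field_simp
  have hnonneg : ∀ n, 0 ≤ residualSeq m F n := fun n => by
    rw [hc]; exact tsum_nonneg fun k => mul_nonneg (by positivity) (hf0 _)
  have hΓ0 : 0 ≤ Γ := hzero ▸ hnonneg 0
  have hcut : ∀ n, F n * Γ ≤ residualSeq m F n := by
    intro n
    have h : ∑' k, r ^ k * F (n + k) ≤ F n * ∑' k, r ^ k * F (0 + k) := by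
      rw [← tsum_mul_left]
      refine (hsumF n).tsum_le_tsum (fun k => ?_) ((hsumF 0).mul_left _)
      have := add_mul_zero_le_of_logConcave (fun k => (hF01 k).1) hFanti hlog.1 n k
      rw [hF0, mul_one] at this
      rw [zero_add]
      nlinarith [pow_pos hr0 k]
    rw [← hzero, hparts, hparts, hF0]
    nlinarith
  -- `f 0 > 0`, since otherwise `F` would be constant
  have hf00 : 0 < f 0 := by
    refine (hf0 0).lt_of_ne fun h => ?_
    have h1 : ∀ n, F n = 1 := by
      intro n
      induction n with
      | zero => exact hF0
      | succ n ih =>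
        have h2 : f n ≤ 0 := h ▸ hfanti (Nat.zero_le n)
        have h3 := hf n
        linarith [hf0 n]
    exact zero_ne_one (tendsto_nhds_unique hlim
      ((tendsto_const_nhds (x := (1 : ℝ))).congr fun n => (h1 n).symm))
  have hbase : Γ * (m + 1) ≤ m * f 0 * (1 + m - m * Γ) := by
    have hd : fwdDiff 1 F 0 = -f 0 := by simp [fwdDiff, hf]
    rw [hd] at hm
    -- if the denominator were not positive, then the quotient would not be positive either
    have hD : 0 < Γ + (1 - Γ) * ((m : ℝ) * -f 0) := by
      by_contra! hD
      have hN : 0 ≤ -(m : ℝ) * -f 0 - Γ := by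
        nlinarith [mul_nonneg hΓ0 (mul_nonneg hmpos.le hf00.le)]
      linarith [div_nonpos_of_nonneg_of_nonpos hN hD]
    rw [le_div_iff₀ hD] at hm
    nlinarith
  -- `residualSeq / f` is largest at `0`, by log-concavity of `f`
  have hratio : ∀ n, residualSeq m F n * f 0 ≤ Γ * f n := by
    intro n
    rw [← hzero, hc, hc, ← tsum_mul_right, ← tsum_mul_right]
    refine ((hsumf n).mul_right _).tsum_le_tsum (fun k => ?_) ((hsumf 0).mul_right _)
    have := add_mul_zero_le_of_logConcave hf0 hfanti hflc n k
    rw [zero_add]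
    nlinarith [pow_pos hr0 (k + 1)]
  have hstep : ∀ n, m * Γ * f n ≤ (m + 1) * (residualSeq m F n - residualSeq m F (n + 1)) := by
    intro n
    have h1 : residualSeq m F n - residualSeq m F (n + 1) = f n - residualSeq m F n / m := by
      rw [hshare n]; ring
    rw [h1]
    have h2 := hratio n
    have h3 : (m * Γ * f n) * (m * f 0)
        ≤ ((m + 1) * (f n - residualSeq m F n / m)) * (m * f 0) := by
      have h4 : ((m + 1) * (f n - residualSeq m F n / m)) * (m * f 0)
          = (m + 1) * (m * f n * f 0 - residualSeq m F n * f 0) := by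
        field_simp
      rw [h4]
      nlinarith [mul_le_mul_of_nonneg_right hbase (hf0 n), mul_le_mul_of_nonneg_left h2
        (by positivity : (0 : ℝ) ≤ m + 1)]
    exact le_of_mul_le_mul_right h3 (by positivity)
  have hsum : ∀ n, m * Γ * (1 - F n) ≤ (m + 1) * (Γ - residualSeq m F n) := by
    intro n
    induction n with
    | zero => rw [hF0, hzero]; simp
    | succ n ih =>
      have h1 := hstep n
      rw [hf] at h1
      nlinarith
  exact
    { F_mem := hF01
      F_zero := hF0
      zero := hzero
      nonneg := hnonneg
      anti := fun n => by
        rw [hc, hc]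
        exact (hsumf _).tsum_le_tsum (fun k => mul_le_mul_of_nonneg_left
          (hfanti (by omega)) (by positivity)) (hsumf _)
      share := fun n => by rw [← hf]; exact hshare n
      cut_mono := hcut
      cut_le := fun n => by
        rw [le_div_iff₀ hmpos]
        nlinarith [hsum n] }

/-! ### Runs, and the guarantee of a discrete OCS along runs -/

/-- The effect on a run state of one more appearance, with edge weight `v`, of a fixed offline
vertex, seen from the weight threshold `x`. A state `(p, n)` records the product `p` of the values
of `F` on the closed runs, and the number `n` of appearances in the current run. An appearance of
weight at least `x` prolongs the current run, any other one closes it. -/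
noncomputable def advance (F : ℕ → ℝ) (v x : ℝ) (s : ℝ × ℕ) : ℝ × ℕ :=
  if x ≤ v then (s.1, s.2 + 1) else (s.1 * F s.2, 0)

theorem iterate_advance_of_le (F : ℕ → ℝ) {v x : ℝ} (h : x ≤ v) (s : ℝ × ℕ) (k : ℕ) :
    (advance F v x)^[k] s = (s.1, s.2 + k) := by
  induction k with
  | zero => rfl
  | succ k ih => rw [Function.iterate_succ_apply', ih, advance, if_pos h, add_assoc]

theorem iterate_advance_of_lt {F : ℕ → ℝ} (hF : F 0 = 1) {v x : ℝ} (h : v < x) (s : ℝ × ℕ)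
    (k : ℕ) : (advance F v x)^[k + 1] s = (s.1 * F s.2, 0) := by
  induction k with
  | zero => simp [advance, not_le.mpr h]
  | succ k ih => rw [Function.iterate_succ_apply', ih, advance, if_neg (not_le.mpr h), hF, mul_one]

/-- The run state of an offline vertex after `t` rounds, if it appears `c τ` times with edge weight
`v τ` in round `τ`. -/
noncomputable def runState (F : ℕ → ℝ) (c : ℕ → ℕ) (v : ℕ → ℝ) (x : ℝ) : ℕ → ℝ × ℕ
  | 0 => (1, 0)
  | t + 1 => (advance F (v t) x)^[c t] (runState F c v x t)

/-- `l` lists, the latest first, nonempty and pairwise disjoint intervals `{a, …, b - 1}` of rounds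
before `t`, all of whose rounds are good. -/
def IsRunList (good : ℕ → Prop) (t : ℕ) (l : List (ℕ × ℕ)) : Prop :=
  l.Pairwise (fun p q => q.2 ≤ p.1) ∧
    ∀ p ∈ l, p.1 < p.2 ∧ p.2 ≤ t ∧ ∀ τ ∈ Finset.Ico p.1 p.2, good τ

/-- The product of the values of `F` over the runs in `l`. -/
noncomputable def runProd (F : ℕ → ℝ) (c : ℕ → ℕ) (l : List (ℕ × ℕ)) : ℝ :=
  (l.map fun p => F (∑ τ ∈ Finset.Ico p.1 p.2, c τ)).prod

theorem IsRunList.mono {good : ℕ → Prop} {s t : ℕ} {l : List (ℕ × ℕ)} (h : IsRunList good s l)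
    (hst : s ≤ t) : IsRunList good t l :=
  ⟨h.1, fun p hp => ⟨(h.2 p hp).1, (h.2 p hp).2.1.trans hst, (h.2 p hp).2.2⟩⟩

/-- The run `{s, …, t - 1}` can be closed; if it is empty, then nothing is added to the list. -/
theorem IsRunList.exists_close {F : ℕ → ℝ} (hF : F 0 = 1) {c : ℕ → ℕ} {good : ℕ → Prop} {s t : ℕ}
    {l : List (ℕ × ℕ)} (h : IsRunList good s l) (hst : s ≤ t)
    (hg : ∀ τ ∈ Finset.Ico s t, good τ) :
    ∃ l', IsRunList good t l' ∧
      runProd F c l' = runProd F c l * F (∑ τ ∈ Finset.Ico s t, c τ) := by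
  rcases hst.eq_or_lt with rfl | hlt
  · exact ⟨l, h, by simp [hF]⟩
  · refine ⟨(s, t) :: l, ⟨List.pairwise_cons.mpr ⟨fun q hq => (h.2 q hq).2.1, h.1⟩, ?_⟩, ?_⟩
    · intro p hp
      rcases List.mem_cons.mp hp with rfl | hp
      · exact ⟨hlt, le_rfl, hg⟩
      · exact (h.mono hst).2 p hp
    · rw [runProd, List.map_cons, List.prod_cons, mul_comm]; rfl

/-- The run state is the product over a list of closed runs, together with the number of
appearances in a current run that starts in round `s`. -/
theorem exists_runList_runState {F : ℕ → ℝ} (hF : F 0 = 1) (c : ℕ → ℕ) (v : ℕ → ℝ) (x : ℝ)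
    (t : ℕ) :
    ∃ s ≤ t, ∃ l, IsRunList (fun τ => c τ ≠ 0 → x ≤ v τ) s l ∧
      (∀ τ ∈ Finset.Ico s t, c τ ≠ 0 → x ≤ v τ) ∧
      runState F c v x t = (runProd F c l, ∑ τ ∈ Finset.Ico s t, c τ) := by
  induction t with
  | zero => exact ⟨0, le_rfl, [], by simp [IsRunList], by simp, by simp [runState, runProd]⟩
  | succ t ih =>
    obtain ⟨s, hst, l, hl, hg, hs⟩ := ih
    by_cases hcut : c t ≠ 0 → x ≤ v t
    · refine ⟨s, by omega, l, hl, ?_, ?_⟩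
      · intro τ hτ
        rw [Finset.mem_Ico] at hτ
        rcases Nat.lt_succ_iff_lt_or_eq.mp hτ.2 with h | rfl
        · exact hg τ (Finset.mem_Ico.mpr ⟨hτ.1, h⟩)
        · exact hcut
      · rw [runState, hs, Finset.sum_Ico_succ_top hst]
        by_cases hc : c t = 0
        · simp [hc]
        · rw [iterate_advance_of_le F (hcut hc)]
    · push Not at hcut
      obtain ⟨k, hk⟩ := Nat.exists_eq_succ_of_ne_zero hcut.1
      obtain ⟨l', hl', hprod⟩ := hl.exists_close hF (c := c) hst hg
      refine ⟨t + 1, le_rfl, l', hl'.mono (by omega), by simp, ?_⟩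
      rw [runState, hk, iterate_advance_of_lt hF hcut.2, hs, hprod]
      simp

/-- The input sequence `A` of an OCS with a step of dummy elements `none` inserted after each step.
The guarantee of a discrete OCS is about intervals of at least two steps; after padding it applies
to single steps of `A` as well. -/
def padded {L : Type} {m : ℕ} (A : ℕ → Sym (Option L) m) (τ : ℕ) : Sym (Option L) m :=
  if τ % 2 = 0 then A (τ / 2) else Sym.replicate m none

section OCS

variable {L : Type} {m : ℕ}

theorem padded_two_mul (A : ℕ → Sym (Option L) m) (t : ℕ) : padded A (2 * t) = A t := by
  simp [padded]

theorem padded_two_mul_add_one (A : ℕ → Sym (Option L) m) (t : ℕ) :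
    padded A (2 * t + 1) = Sym.replicate m none := by
  simp [padded, Nat.add_mod]

theorem winner_padded_odd (O : DiscreteOCS (Option L) m) (A : ℕ → Sym (Option L) m) (t : ℕ)
    (ω : O.Ω) : O.winner (padded A) (2 * t + 1) ω = none := by
  have h := O.act_mem (2 * t + 1) (fun s => padded A s) ω
  rw [Fin.val_last, padded_two_mul_add_one] at h
  exact Multiset.eq_of_mem_replicate h

theorem ne_zero_of_discreteOCS (O : DiscreteOCS L m) : m ≠ 0 := by
  rintro rfl
  obtain ⟨ω⟩ : Nonempty O.Ω := nonempty_of_isProbabilityMeasure O.μ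
  have h := O.act_mem 0 (fun _ => Sym.nil) ω
  exact absurd h (Sym.notMem_nil _)

variable [DecidableEq L]

theorem count_padded (A : ℕ → Sym (Option L) m) (i : L) {a b : ℕ} (hab : a < b) :
    DiscreteOCS.count (padded A) (some i) (2 * a) (2 * b - 1)
      = ∑ τ ∈ Finset.Ico a b, (A τ : Multiset (Option L)).count (some i) := by
  have key : ∀ b, a ≤ b →
      ∑ τ ∈ Finset.Ico (2 * a) (2 * b), (padded A τ : Multiset (Option L)).count (some i)
        = ∑ τ ∈ Finset.Ico a b, (A τ : Multiset (Option L)).count (some i) := by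
    intro b hb
    induction b, hb using Nat.le_induction with
    | base => simp
    | succ b hb ih =>
      rw [show 2 * (b + 1) = 2 * b + 1 + 1 by ring, Finset.sum_Ico_succ_top (by omega),
        Finset.sum_Ico_succ_top (by omega), ih, Finset.sum_Ico_succ_top hb, padded_two_mul,
        padded_two_mul_add_one]
      simp [Sym.replicate, Multiset.count_replicate]
  rw [← key b hab.le, DiscreteOCS.count]
  congr 1
  ext τ
  simp only [Finset.mem_Icc, Finset.mem_Ico]
  omega

/-- The guarantee of an OCS, fed with a padded sequence, along a list of runs. -/
theorem measureReal_le_runProd {F : ℕ → ℝ} {O : DiscreteOCS (Option L) m} (hO : O.HasParameter F)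
    (A : ℕ → Sym (Option L) m) (i : L) {good : ℕ → Prop} {T : ℕ} {l : List (ℕ × ℕ)}
    (hl : IsRunList good T l) :
    O.μ.real {ω | ∀ t < T, good t → O.winner (padded A) (2 * t) ω ≠ some i}
      ≤ runProd F (fun τ => (A τ : Multiset (Option L)).count (some i)) l := by
  have hmem : ∀ ℓ : Fin l.length, l.get ℓ ∈ l := List.get_mem l
  have hsep : ∀ ℓ ℓ' : Fin l.length, ℓ < ℓ' → (l.get ℓ').2 ≤ (l.get ℓ).1 :=
    List.pairwise_iff_get.mp hl.1
  have h := hO (padded A) (some i) l.length (fun ℓ => 2 * (l.get ℓ).1)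
    (fun ℓ => 2 * (l.get ℓ).2 - 1)
    (fun ℓ => by have := (hl.2 _ (hmem ℓ)).1; omega)
    (fun ℓ ℓ' hne => by
      rw [Finset.disjoint_left]
      intro τ h1 h2
      rw [Finset.mem_Icc] at h1 h2
      have h3 := (hl.2 _ (hmem ℓ)).1
      have h4 := (hl.2 _ (hmem ℓ')).1
      rcases lt_or_gt_of_ne hne with h5 | h5
      · have := hsep _ _ h5; omega
      · have := hsep _ _ h5; omega)
  refine (measureReal_mono ?_).trans (h.trans_eq ?_)
  · intro ω hω ℓ τ hτ
    obtain ⟨h1, h2, h3⟩ := hl.2 _ (hmem ℓ)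
    rw [Finset.mem_Icc] at hτ
    rcases Nat.even_or_odd' τ with ⟨t, rfl | rfl⟩
    · exact hω t (by omega) (h3 t (Finset.mem_Ico.mpr (by omega)))
    · rw [winner_padded_odd]; exact (Option.some_ne_none i).symm
  · rw [runProd, ← Fin.prod_univ_fun_getElem]
    refine Finset.prod_congr rfl fun ℓ _ => ?_
    rw [count_padded A i (hl.2 _ (hmem ℓ)).1]
    rfl

/-- The probability that `i` wins in no round in which its weight is at least `x` is bounded by
the run state. -/
theorem measureReal_le_runState {F : ℕ → ℝ} (hF : F 0 = 1) {O : DiscreteOCS (Option L) m}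
    (hO : O.HasParameter F) (A : ℕ → Sym (Option L) m) (i : L) (v : ℕ → ℝ) (x : ℝ) (T : ℕ) :
    O.μ.real {ω | ∀ t < T, x ≤ v t → O.winner (padded A) (2 * t) ω ≠ some i}
      ≤ (runState F (fun τ => (A τ : Multiset (Option L)).count (some i)) v x T).1 *
        F (runState F (fun τ => (A τ : Multiset (Option L)).count (some i)) v x T).2 := by
  obtain ⟨s, hs, l, hl, hg, hrun⟩ := exists_runList_runState hF
    (fun τ => (A τ : Multiset (Option L)).count (some i)) v x T
  obtain ⟨l', hl', hprod⟩ := hl.exists_close hF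
    (c := fun τ => (A τ : Multiset (Option L)).count (some i)) hs hg
  rw [hrun, ← hprod]
  refine (measureReal_mono ?_).trans (measureReal_le_runProd hO A i hl')
  intro ω hω t ht hgood hwin
  -- a winner of a round appears in that round
  refine hω t ht (hgood ?_) hwin
  have h := O.act_mem (2 * t) (fun s => padded A s) ω
  rw [Fin.val_last, padded_two_mul] at h
  rw [Multiset.count_ne_zero, ← hwin]
  exact h

/-- A discrete OCS exists only if `F 0 = 1`: an element that never appears never wins. -/
theorem one_le_F_zero {F : ℕ → ℝ} {O : DiscreteOCS (Option L) m} (hO : O.HasParameter F) (i : L) :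
    1 ≤ F 0 := by
  have h := hO (fun _ => Sym.replicate m none) (some i) 1 (fun _ => 0) (fun _ => 1)
    (fun _ => zero_lt_one) (fun ℓ ℓ' hne => absurd (Subsingleton.elim ℓ ℓ') hne)
  have hc : DiscreteOCS.count (fun _ => Sym.replicate m (none : Option L)) (some i) 0 1 = 0 := by
    simp [DiscreteOCS.count, Sym.replicate, Multiset.count_replicate]
  have hu : {ω : O.Ω | ∀ ℓ : Fin 1, ∀ t ∈ Finset.Icc 0 1,
      O.winner (fun _ => Sym.replicate m none) t ω ≠ some i} = Set.univ := by
    refine Set.eq_univ_of_forall fun ω _ t _ => ?_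
    have h := O.act_mem t (fun _ => Sym.replicate m none) ω
    rw [show O.winner (fun _ => Sym.replicate m none) t ω = none from
      Multiset.eq_of_mem_replicate h]
    exact (Option.some_ne_none i).symm
  rw [hu, hc] at h
  simpa using h

end OCS

/-! ### The primal-dual potential of one offline vertex -/

/-- The share of a unit of weight threshold in the dual variable of an offline vertex. -/
def dualShare (Γ : ℝ) (c : ℕ → ℝ) (s : ℝ × ℕ) : ℝ := Γ - s.1 * c s.2

/-- The guaranteed probability that an offline vertex in the run state `s` has been won. -/
def primalShare (F : ℕ → ℝ) (s : ℝ × ℕ) : ℝ := 1 - s.1 * F s.2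

/-- A family of run states, indexed by the weight thresholds, over which the shares can be
integrated. -/
structure IsRunProfile (S : ℝ → ℝ × ℕ) : Prop where
  measurable : Measurable S
  eventually_init : ∃ M, ∀ x, M < x → S x = (1, 0)
  mem_Icc : ∀ x, (S x).1 ∈ Set.Icc (0 : ℝ) 1

/-- The dual variable of an offline vertex. -/
noncomputable def dualVar (Γ : ℝ) (c : ℕ → ℝ) (S : ℝ → ℝ × ℕ) : ℝ :=
  ∫ x in Set.Ioi 0, dualShare Γ c (S x)

/-- The guaranteed expected contribution of an offline vertex to the total weight. -/
noncomputable def primalVal (F : ℕ → ℝ) (S : ℝ → ℝ × ℕ) : ℝ :=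
  ∫ x in Set.Ioi 0, primalShare F (S x)

theorem integrableOn_Ioi_of_bounded {h : ℝ → ℝ} (hm : Measurable h) {C M : ℝ}
    (hC : ∀ x, |h x| ≤ C) (hM : ∀ x, M < x → h x = 0) : IntegrableOn h (Set.Ioi 0) := by
  have h1 : IntegrableOn h (Set.Ioc 0 M) :=
    Measure.integrableOn_of_bounded (M := C) (by simp) hm.aestronglyMeasurable
      (Filter.Eventually.of_forall hC)
  refine h1.of_forall_sdiff_eq_zero measurableSet_Ioi fun x hx => hM x ?_
  by_contra! h
  exact hx.2 ⟨hx.1, h⟩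

theorem isRunProfile_init : IsRunProfile fun _ => (1, 0) :=
  ⟨measurable_const, ⟨0, fun _ _ => rfl⟩, fun _ => by simp⟩

section Potential

variable {m : ℕ} {F : ℕ → ℝ} {Γ : ℝ} {c : ℕ → ℝ}

theorem IsResidual.le_ratio (hR : IsResidual m F Γ c) (n : ℕ) : c n ≤ Γ :=
  hR.zero ▸ antitone_nat_of_succ_le hR.anti (Nat.zero_le n)

theorem IsRunProfile.advance (hR : IsResidual m F Γ c) {S : ℝ → ℝ × ℕ} (hS : IsRunProfile S)
    (v : ℝ) : IsRunProfile fun x => advance F v x (S x) := by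
  obtain ⟨hmeas, ⟨M, hM⟩, hmem⟩ := hS
  refine ⟨?_, ⟨max M v, fun x hx => ?_⟩, fun x => ?_⟩
  · have h2 : Measurable fun x => F (S x).2 := (measurable_of_countable F).comp hmeas.snd
    have h3 : Measurable fun x => (S x).2 + 1 :=
      (measurable_of_countable fun n : ℕ => n + 1).comp hmeas.snd
    exact Measurable.ite measurableSet_Iic (hmeas.fst.prodMk h3)
      ((hmeas.fst.mul h2).prodMk measurable_const)
  · rw [max_lt_iff] at hx
    rw [_root_.advance, if_neg (not_le.mpr hx.2), hM x hx.1, hR.F_zero, mul_one]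
  · rw [_root_.advance]
    split_ifs
    · exact hmem x
    · exact ⟨mul_nonneg (hmem x).1 (hR.F_mem _).1,
        mul_le_one₀ (hmem x).2 (hR.F_mem _).1 (hR.F_mem _).2⟩

theorem IsRunProfile.integrableOn_dualShare (hR : IsResidual m F Γ c) {S : ℝ → ℝ × ℕ}
    (hS : IsRunProfile S) : IntegrableOn (fun x => dualShare Γ c (S x)) (Set.Ioi 0) := by
  obtain ⟨hmeas, ⟨M, hM⟩, hmem⟩ := hS
  refine integrableOn_Ioi_of_bounded (C := Γ) (M := M) ?_ (fun x => ?_) (fun x hx => ?_)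
  · exact measurable_const.sub
      (hmeas.fst.mul ((measurable_of_countable c).comp hmeas.snd))
  · have h1 := mul_nonneg (hmem x).1 (hR.nonneg (S x).2)
    have h2 := mul_le_of_le_one_left (hR.nonneg (S x).2) (hmem x).2
    have h3 := hR.le_ratio (S x).2
    rw [dualShare, abs_of_nonneg (by linarith)]
    linarith
  · simp [dualShare, hM x hx, hR.zero]

theorem IsRunProfile.integrableOn_primalShare (hR : IsResidual m F Γ c) {S : ℝ → ℝ × ℕ}
    (hS : IsRunProfile S) : IntegrableOn (fun x => primalShare F (S x)) (Set.Ioi 0) := by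
  obtain ⟨hmeas, ⟨M, hM⟩, hmem⟩ := hS
  refine integrableOn_Ioi_of_bounded (C := 1) (M := M) ?_ (fun x => ?_) (fun x hx => ?_)
  · exact measurable_const.sub
      (hmeas.fst.mul ((measurable_of_countable F).comp hmeas.snd))
  · have h1 := mul_nonneg (hmem x).1 (hR.F_mem (S x).2).1
    have h2 := mul_le_one₀ (hmem x).2 (hR.F_mem (S x).2).1 (hR.F_mem (S x).2).2
    rw [primalShare, abs_of_nonneg (by linarith)]
    linarith
  · simp [primalShare, hM x hx, hR.F_zero]

theorem dualVar_init (hR : IsResidual m F Γ c) : dualVar Γ c (fun _ => (1, 0)) = 0 := by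
  simp [dualVar, dualShare, hR.zero]

theorem primalVal_init (hR : IsResidual m F Γ c) : primalVal F (fun _ => (1, 0)) = 0 := by
  simp [primalVal, primalShare, hR.F_zero]

/-- Appearances never lower the dual variable of an offline vertex. -/
theorem dualVar_le_advance (hR : IsResidual m F Γ c) {S : ℝ → ℝ × ℕ} (hS : IsRunProfile S) (v : ℝ) :
    dualVar Γ c S ≤ dualVar Γ c fun x => advance F v x (S x) := by
  refine setIntegral_mono (hS.integrableOn_dualShare hR)
    ((hS.advance hR v).integrableOn_dualShare hR) fun x => ?_
  have h0 := (hS.mem_Icc x).1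
  simp only [dualShare, advance]
  split_ifs
  · have := mul_le_mul_of_nonneg_left (hR.anti (S x).2) h0
    linarith
  · have := mul_le_mul_of_nonneg_left (hR.cut_mono (S x).2) h0
    rw [hR.zero]
    linarith

/-- The primal gain of an appearance, at a single threshold, pays for the increase of the dual
share and for a fraction `1 / m` of what is missing from dual feasibility. -/
theorem share_advance_le (hR : IsResidual m F Γ c) {s : ℝ × ℕ} (hs : s.1 ∈ Set.Icc (0 : ℝ) 1)
    (v x : ℝ) :
    primalShare F s + ((dualShare Γ c (advance F v x s) - dualShare Γ c s)
        + ((Set.Iic v).indicator (fun _ => Γ) x - dualShare Γ c s) / m)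
      ≤ primalShare F (advance F v x s) := by
  obtain ⟨p, n⟩ := s
  simp only [dualShare, primalShare, advance, Set.indicator, Set.mem_Iic]
  split_ifs with h
  · have h1 := hR.share n
    have h2 : p * (F n - F (n + 1)) = p * (c n - c (n + 1) + c n / m) := by rw [h1]
    have h3 : (Γ - (Γ - p * c n)) / m = p * (c n / m) := by ring
    simp only [h3]
    linarith
  · -- the inequality is affine in `p`, trivial at `p = 0`, and `cut_le` at `p = 1`
    have h1 := mul_le_mul_of_nonneg_left (hR.cut_le n) hs.1
    have h2 : 0 ≤ (1 - p) * (Γ / m) :=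
      mul_nonneg (sub_nonneg.mpr hs.2)
        (div_nonneg ((hR.nonneg n).trans (hR.le_ratio n)) (Nat.cast_nonneg m))
    have h3 : (0 - (Γ - p * c n)) / m = -(p * ((Γ - c n) / m)) - (1 - p) * (Γ / m) := by ring
    simp only [h3, hR.zero, hR.F_zero]
    linarith

/-- Integrated form of `share_advance_le`. -/
theorem primalVal_advance (hR : IsResidual m F Γ c) {S : ℝ → ℝ × ℕ} (hS : IsRunProfile S) {v : ℝ}
    (hv : 0 ≤ v) :
    primalVal F S + ((dualVar Γ c (fun x => advance F v x (S x)) - dualVar Γ c S)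
        + (Γ * v - dualVar Γ c S) / m)
      ≤ primalVal F fun x => advance F v x (S x) := by
  have hS' := hS.advance hR v
  have hp := hS.integrableOn_primalShare hR
  have hd := hS.integrableOn_dualShare hR
  have hd' := hS'.integrableOn_dualShare hR
  have hi : IntegrableOn ((Set.Iic v).indicator fun _ => Γ) (Set.Ioi 0) :=
    integrableOn_Ioi_of_bounded (C := |Γ|) (M := v)
      (measurable_const.indicator measurableSet_Iic)
      (fun x => by by_cases h : x ∈ Set.Iic v <;> simp [h])
      (fun x hx => by simp [hx])
  have hiv : ∫ x in Set.Ioi (0 : ℝ), (Set.Iic v).indicator (fun _ => Γ) x = Γ * v := by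
    rw [setIntegral_indicator measurableSet_Iic, Set.Ioi_inter_Iic, setIntegral_const]
    simp [hv, mul_comm]
  rw [← hiv]
  unfold primalVal dualVar
  have hg : IntegrableOn (fun x => dualShare Γ c (advance F v x (S x)) - dualShare Γ c (S x))
      (Set.Ioi 0) := hd'.sub hd
  have ho : IntegrableOn (fun x => ((Set.Iic v).indicator (fun _ => Γ) x - dualShare Γ c (S x)) / m)
      (Set.Ioi 0) := (hi.sub hd).div_const _
  have hgo : IntegrableOn (fun x => dualShare Γ c (advance F v x (S x)) - dualShare Γ c (S x)
      + ((Set.Iic v).indicator (fun _ => Γ) x - dualShare Γ c (S x)) / m) (Set.Ioi 0) := hg.add ho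
  rw [← integral_sub hd' hd, ← integral_sub hi hd, ← integral_div, ← integral_add hg ho,
    ← integral_add hp hgo]
  exact setIntegral_mono (hp.add hgo)
    (hS'.integrableOn_primalShare hR) fun x => share_advance_le hR (hS.mem_Icc x) v x

end Potential

/-! ### The greedy choice of the input of the OCS -/

section Greedy

variable {L : Type}

/-- The offer of an offline vertex to an online vertex with the weights `v`: the amount by which
dual feasibility of their edge fails. The dummy element `none` offers `0`. -/
noncomputable def offer (Γ : ℝ) (c : ℕ → ℝ) (v : L → ℝ≥0) (S : L → ℝ → ℝ × ℕ) : Option L → ℝ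
  | none => 0
  | some i => Γ * v i - dualVar Γ c (S i)

/-- An element making a largest offer. -/
noncomputable def bestOffer [Finite L] (Γ : ℝ) (c : ℕ → ℝ) (v : L → ℝ≥0) (S : L → ℝ → ℝ × ℕ) :
    Option L :=
  (Finite.exists_max (offer Γ c v S)).choose

theorem offer_le_bestOffer [Finite L] (Γ : ℝ) (c : ℕ → ℝ) (v : L → ℝ≥0) (S : L → ℝ → ℝ × ℕ)
    (o : Option L) : offer Γ c v S o ≤ offer Γ c v S (bestOffer Γ c v S) :=
  (Finite.exists_max (offer Γ c v S)).choose_spec o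

theorem bestOffer_nonneg [Finite L] (Γ : ℝ) (c : ℕ → ℝ) (v : L → ℝ≥0) (S : L → ℝ → ℝ × ℕ) :
    0 ≤ offer Γ c v S (bestOffer Γ c v S) :=
  offer_le_bestOffer Γ c v S none

variable [DecidableEq L]

/-- The run states after one more appearance of `o`; the dummy element `none` has no run state. -/
noncomputable def award (F : ℕ → ℝ) (v : L → ℝ≥0) (S : L → ℝ → ℝ × ℕ) :
    Option L → L → ℝ → ℝ × ℕ
  | none => S
  | some i => Function.update S i fun x => advance F (v i) x (S i x)

/-- One greedy choice of an element of the input of the OCS. -/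
noncomputable def greedyStep [Finite L] (F : ℕ → ℝ) (Γ : ℝ) (c : ℕ → ℝ) (v : L → ℝ≥0)
    (S : L → ℝ → ℝ × ℕ) : L → ℝ → ℝ × ℕ :=
  award F v S (bestOffer Γ c v S)

/-- The first `k` greedy choices. -/
noncomputable def greedyPicks [Finite L] (F : ℕ → ℝ) (Γ : ℝ) (c : ℕ → ℝ) (v : L → ℝ≥0)
    (S : L → ℝ → ℝ × ℕ) (k : ℕ) : Multiset (Option L) :=
  (Multiset.range k).map fun q => bestOffer Γ c v ((greedyStep F Γ c v)^[q] S)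

/-- The run states after `t` rounds of `m` greedy choices each, with the weights `W`. -/
noncomputable def greedyState [Finite L] (m : ℕ) (F : ℕ → ℝ) (Γ : ℝ) (c : ℕ → ℝ)
    (W : ℕ → L → ℝ≥0) : ℕ → L → ℝ → ℝ × ℕ
  | 0 => fun _ _ => (1, 0)
  | t + 1 => (greedyStep F Γ c (W t))^[m] (greedyState m F Γ c W t)

/-- The input of the OCS in round `t`. -/
noncomputable def greedyInput [Finite L] (m : ℕ) (F : ℕ → ℝ) (Γ : ℝ) (c : ℕ → ℝ)
    (W : ℕ → L → ℝ≥0) (t : ℕ) : Sym (Option L) m :=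
  ⟨greedyPicks F Γ c (W t) (greedyState m F Γ c W t) m, by simp [greedyPicks]⟩

/-- The dual variable of the online vertex that arrives in round `t`: the average of the accepted
offers. -/
noncomputable def onlineDual [Finite L] (m : ℕ) (F : ℕ → ℝ) (Γ : ℝ) (c : ℕ → ℝ)
    (W : ℕ → L → ℝ≥0) (t : ℕ) : ℝ :=
  ∑ q ∈ Finset.range m,
    (fun S => offer Γ c (W t) S (bestOffer Γ c (W t) S) / m)
      ((greedyStep F Γ c (W t))^[q] (greedyState m F Γ c W t))

theorem iterate_greedyStep_apply [Finite L] (F : ℕ → ℝ) (Γ : ℝ) (c : ℕ → ℝ) (v : L → ℝ≥0)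
    (S : L → ℝ → ℝ × ℕ) (k : ℕ) (i : L) (x : ℝ) :
    (greedyStep F Γ c v)^[k] S i x
      = (advance F (v i) x)^[(greedyPicks F Γ c v S k).count (some i)] (S i x) := by
  induction k with
  | zero => simp [greedyPicks]
  | succ k ih =>
    have hp : greedyPicks F Γ c v S (k + 1)
        = bestOffer Γ c v ((greedyStep F Γ c v)^[k] S) ::ₘ greedyPicks F Γ c v S k := by
      simp [greedyPicks, Multiset.range_succ]
    rw [Function.iterate_succ_apply', hp, Multiset.count_cons]
    generalize (greedyStep F Γ c v)^[k] S = S' at ih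
    rw [greedyStep]
    rcases bestOffer Γ c v S' with _ | j
    · simpa [award] using ih
    · by_cases hij : i = j
      · subst hij
        simp only [award, Function.update_self, if_true]
        rw [Function.iterate_succ_apply', ih]
      · simpa [award, Function.update_of_ne hij, hij] using ih

theorem greedyState_apply [Finite L] (m : ℕ) (F : ℕ → ℝ) (Γ : ℝ) (c : ℕ → ℝ)
    (W : ℕ → L → ℝ≥0) (t : ℕ) (i : L) (x : ℝ) :
    greedyState m F Γ c W t i x
      = runState F
          (fun τ => (greedyInput m F Γ c W τ : Multiset (Option L)).count (some i))
          (fun τ => W τ i) x t := by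
  induction t with
  | zero => rfl
  | succ t ih => rw [greedyState, iterate_greedyStep_apply, runState, ih]; rfl

/-- The greedy choices are online: they depend on the weights revealed so far only. -/
theorem greedyState_congr [Finite L] {m : ℕ} {F : ℕ → ℝ} {Γ : ℝ} {c : ℕ → ℝ}
    {W W' : ℕ → L → ℝ≥0} {t : ℕ} (h : ∀ τ < t, W τ = W' τ) :
    greedyState m F Γ c W t = greedyState m F Γ c W' t := by
  induction t with
  | zero => rfl
  | succ t ih => rw [greedyState, greedyState, ih fun τ hτ => h τ (by omega), h t (by omega)]

theorem greedyInput_congr [Finite L] {m : ℕ} {F : ℕ → ℝ} {Γ : ℝ} {c : ℕ → ℝ}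
    {W W' : ℕ → L → ℝ≥0} {t : ℕ} (h : ∀ τ ≤ t, W τ = W' τ) :
    greedyInput m F Γ c W t = greedyInput m F Γ c W' t := by
  refine Subtype.ext ?_
  simp only [greedyInput, greedyState_congr fun τ hτ => h τ (le_of_lt hτ), h t le_rfl]

variable {m : ℕ} {F : ℕ → ℝ} {Γ : ℝ} {c : ℕ → ℝ}

theorem onlineDual_nonneg [Finite L] (W : ℕ → L → ℝ≥0) (t : ℕ) : 0 ≤ onlineDual m F Γ c W t :=
  Finset.sum_nonneg fun _ _ => div_nonneg (bestOffer_nonneg _ _ _ _) (Nat.cast_nonneg m)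

theorem isRunProfile_greedyStep [Finite L] (hR : IsResidual m F Γ c) (v : L → ℝ≥0)
    {S : L → ℝ → ℝ × ℕ} (hS : ∀ i, IsRunProfile (S i)) (i : L) :
    IsRunProfile (greedyStep F Γ c v S i) := by
  rw [greedyStep]
  rcases bestOffer Γ c v S with _ | j
  · exact hS i
  · by_cases hij : i = j
    · subst hij
      simpa only [award, Function.update_self] using (hS i).advance hR (v i)
    · simpa only [award, Function.update_of_ne hij] using hS i

theorem isRunProfile_iterate_greedyStep [Finite L] (hR : IsResidual m F Γ c) (v : L → ℝ≥0)
    {S : L → ℝ → ℝ × ℕ} (hS : ∀ i, IsRunProfile (S i)) (k : ℕ) (i : L) :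
    IsRunProfile ((greedyStep F Γ c v)^[k] S i) := by
  induction k generalizing i with
  | zero => exact hS i
  | succ k ih => rw [Function.iterate_succ_apply']; exact isRunProfile_greedyStep hR v ih i

theorem isRunProfile_greedyState [Finite L] (hR : IsResidual m F Γ c) (W : ℕ → L → ℝ≥0) (t : ℕ)
    (i : L) : IsRunProfile (greedyState m F Γ c W t i) := by
  induction t generalizing i with
  | zero => exact isRunProfile_init
  | succ t ih => exact isRunProfile_iterate_greedyStep hR (W t) ih m i

theorem dualVar_le_greedyStep [Finite L] (hR : IsResidual m F Γ c) (v : L → ℝ≥0)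
    {S : L → ℝ → ℝ × ℕ} (hS : ∀ i, IsRunProfile (S i)) (i : L) :
    dualVar Γ c (S i) ≤ dualVar Γ c (greedyStep F Γ c v S i) := by
  rw [greedyStep]
  rcases bestOffer Γ c v S with _ | j
  · exact le_rfl
  · by_cases hij : i = j
    · subst hij
      simpa only [award, Function.update_self] using dualVar_le_advance hR (hS i) (v i)
    · simp only [award, Function.update_of_ne hij, le_refl]

theorem dualVar_iterate_mono [Finite L] (hR : IsResidual m F Γ c) (v : L → ℝ≥0)
    {S : L → ℝ → ℝ × ℕ} (hS : ∀ i, IsRunProfile (S i)) (i : L) :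
    Monotone fun k => dualVar Γ c ((greedyStep F Γ c v)^[k] S i) :=
  monotone_nat_of_le_succ fun k => by
    rw [Function.iterate_succ_apply']
    exact dualVar_le_greedyStep hR v (isRunProfile_iterate_greedyStep hR v hS k) i

theorem dualVar_greedyState_mono [Finite L] (hR : IsResidual m F Γ c) (W : ℕ → L → ℝ≥0) (i : L) :
    Monotone fun t => dualVar Γ c (greedyState m F Γ c W t i) :=
  monotone_nat_of_le_succ fun t =>
    dualVar_iterate_mono hR (W t) (isRunProfile_greedyState hR W t) i (Nat.zero_le m)

theorem dualVar_greedyState_nonneg [Finite L] (hR : IsResidual m F Γ c) (W : ℕ → L → ℝ≥0)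
    (t : ℕ) (i : L) : 0 ≤ dualVar Γ c (greedyState m F Γ c W t i) :=
  (dualVar_init hR).symm.le.trans (dualVar_greedyState_mono hR W i (Nat.zero_le t))

/-- Dual feasibility. Each of the `m` accepted offers was at least the offer of `i` at that moment,
which is at least what `i` would offer at the end, since dual variables only grow. -/
theorem dual_feasible [Finite L] (hR : IsResidual m F Γ c) (hm : m ≠ 0) (W : ℕ → L → ℝ≥0)
    {t T : ℕ} (ht : t < T) (i : L) :
    Γ * W t i ≤ dualVar Γ c (greedyState m F Γ c W T i) + onlineDual m F Γ c W t := by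
  have h1 : (Γ * W t i - dualVar Γ c (greedyState m F Γ c W (t + 1) i)) ≤
      onlineDual m F Γ c W t := by
    have h2 : ∑ _q ∈ Finset.range m,
        (Γ * W t i - dualVar Γ c (greedyState m F Γ c W (t + 1) i)) / m
          ≤ onlineDual m F Γ c W t := by
      refine Finset.sum_le_sum fun q hq => ?_
      refine div_le_div_of_nonneg_right ?_ (Nat.cast_nonneg m)
      refine le_trans ?_ (offer_le_bestOffer Γ c (W t) _ (some i))
      exact sub_le_sub_left (dualVar_iterate_mono hR (W t) (isRunProfile_greedyState hR W t) i
        (Finset.mem_range.mp hq).le) _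
    rwa [Finset.sum_const, Finset.card_range, nsmul_eq_mul,
      mul_div_cancel₀ _ (Nat.cast_ne_zero.mpr hm)] at h2
  linarith [dualVar_greedyState_mono hR W i (show t + 1 ≤ T from ht)]

variable [Fintype L]

/-- The primal value minus the dual variables of the offline vertices. -/
noncomputable def surplus (F : ℕ → ℝ) (Γ : ℝ) (c : ℕ → ℝ) (S : L → ℝ → ℝ × ℕ) : ℝ :=
  ∑ i, (primalVal F (S i) - dualVar Γ c (S i))

theorem surplus_greedyStep (hR : IsResidual m F Γ c) (v : L → ℝ≥0)
    {S : L → ℝ → ℝ × ℕ} (hS : ∀ i, IsRunProfile (S i)) :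
    surplus F Γ c S + offer Γ c v S (bestOffer Γ c v S) / m
      ≤ surplus F Γ c (greedyStep F Γ c v S) := by
  rw [greedyStep]
  rcases bestOffer Γ c v S with _ | j
  · simp [award, offer]
  · rw [surplus, surplus, ← Finset.add_sum_erase _ _ (Finset.mem_univ j),
      ← Finset.add_sum_erase _ _ (Finset.mem_univ j)]
    have h1 : ∑ i ∈ Finset.univ.erase j,
          (primalVal F (award F v S (some j) i) - dualVar Γ c (award F v S (some j) i))
        = ∑ i ∈ Finset.univ.erase j, (primalVal F (S i) - dualVar Γ c (S i)) :=
      Finset.sum_congr rfl fun i hi => by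
        rw [award, Function.update_of_ne (Finset.ne_of_mem_erase hi)]
    rw [h1]
    simp only [award, Function.update_self, offer]
    linarith [primalVal_advance hR (hS j) (v j).coe_nonneg]

theorem surplus_iterate_greedyStep (hR : IsResidual m F Γ c) (v : L → ℝ≥0)
    {S : L → ℝ → ℝ × ℕ} (hS : ∀ i, IsRunProfile (S i)) (k : ℕ) :
    surplus F Γ c S + ∑ q ∈ Finset.range k,
        (fun S => offer Γ c v S (bestOffer Γ c v S) / m) ((greedyStep F Γ c v)^[q] S)
      ≤ surplus F Γ c ((greedyStep F Γ c v)^[k] S) := by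
  induction k with
  | zero => simp
  | succ k ih =>
    rw [Finset.sum_range_succ, Function.iterate_succ_apply']
    linarith [surplus_greedyStep hR v (isRunProfile_iterate_greedyStep hR v hS k)]

/-- The primal value dominates the dual value. -/
theorem sum_dual_le_sum_primalVal (hR : IsResidual m F Γ c) (W : ℕ → L → ℝ≥0) (T : ℕ) :
    ∑ i, dualVar Γ c (greedyState m F Γ c W T i) + ∑ t ∈ Finset.range T, onlineDual m F Γ c W t
      ≤ ∑ i, primalVal F (greedyState m F Γ c W T i) := by
  have h : ∑ t ∈ Finset.range T, onlineDual m F Γ c W t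
      ≤ surplus F Γ c (greedyState m F Γ c W T) := by
    induction T with
    | zero => simp [surplus, greedyState, dualVar_init hR, primalVal_init hR]
    | succ T ih =>
      rw [Finset.sum_range_succ]
      exact (add_le_add_left ih _).trans
        (surplus_iterate_greedyStep hR (W T) (isRunProfile_greedyState hR W T) m)
  rw [surplus, Finset.sum_sub_distrib] at h
  linarith

end Greedy

/-! ### Weak duality -/

/-- Weak duality for the linear program of the maximum weight matching. -/
theorem mul_optimalWeight_le {L : Type} [Fintype L] [DecidableEq L] {T : ℕ}
    (w : Fin T → L → ℝ≥0) {Γ : ℝ} {α : L → ℝ} {β : Fin T → ℝ} (hα : ∀ i, 0 ≤ α i)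
    (hβ : ∀ j, 0 ≤ β j) (h : ∀ i j, Γ * w j i ≤ α i + β j) :
    Γ * (optimalWeight w : ℝ) ≤ ∑ i, α i + ∑ j, β j := by
  obtain ⟨σ, -, hσ⟩ := Finset.exists_mem_eq_sup (Finset.univ : Finset (Fin T → Option L))
    Finset.univ_nonempty fun σ => matchingWeight w σ
  have hi : ∀ i, Γ * (((Finset.univ.filter fun j => σ j = some i).sup fun j => w j i : ℝ≥0) : ℝ)
      ≤ α i + ∑ j, if σ j = some i then β j else 0 := by
    intro i
    rw [← Finset.sum_filter]
    rcases (Finset.univ.filter fun j => σ j = some i).eq_empty_or_nonempty with he | hne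
    · simp [he, hα i]
    · obtain ⟨j, hj, hsup⟩ := Finset.exists_mem_eq_sup _ hne fun j => w j i
      rw [hsup]
      have := Finset.single_le_sum (f := β) (fun j _ => hβ j) hj
      linarith [h i j]
  rw [optimalWeight, hσ, matchingWeight, NNReal.coe_sum, Finset.mul_sum]
  refine (Finset.sum_le_sum fun i _ => hi i).trans ?_
  rw [Finset.sum_add_distrib, Finset.sum_comm]
  refine add_le_add_right (Finset.sum_le_sum fun j _ => ?_) _
  rcases σ j with _ | i
  · simpa using hβ j
  · simp

/-! ### The matching algorithm -/

/-- The sequence of online vertices, continued by vertices without edges. -/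
def extendByZero {L : Type} {T : ℕ} (w : Fin T → L → ℝ≥0) (t : ℕ) : L → ℝ≥0 :=
  if h : t < T then w ⟨t, h⟩ else 0

theorem extendByZero_coe {L : Type} {T : ℕ} (w : Fin T → L → ℝ≥0) (j : Fin T) :
    extendByZero w j = w j := by
  simp [extendByZero]

/-- The algorithm that feeds the greedy choices to a discrete OCS and matches the online vertex
to the winner, provided that they are adjacent. -/
noncomputable def greedyMatching {L : Type} [Finite L] [DecidableEq L] {m : ℕ} (F : ℕ → ℝ) (Γ : ℝ)
    (c : ℕ → ℝ) (O : DiscreteOCS (Option L) m) : OnlineMatchingAlgorithm L where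
  Ω := O.Ω
  μ := O.μ
  act t h ω := (O.act (2 * t) (fun s => padded (greedyInput m F Γ c (extendByZero h)) s) ω).filter
    fun i => 0 < h (Fin.last t) i
  measurable_act t h y := by
    have : {ω | (O.act (2 * t) (fun s => padded (greedyInput m F Γ c (extendByZero h)) s)
          ω).filter (fun i => 0 < h (Fin.last t) i) = y}
        = ⋃ z ∈ {z : Option L | z.filter (fun i => 0 < h (Fin.last t) i) = y},
          {ω | O.act (2 * t) (fun s => padded (greedyInput m F Γ c (extendByZero h)) s) ω = z} := by
      ext ω
      simp
    rw [this]
    exact MeasurableSet.biUnion (Set.to_countable _) fun z _ => O.measurable_act _ _ z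
  act_edge t h ω i hi := by
    simpa using (Option.filter_eq_some_iff.mp hi).2

section Competitive

variable {L : Type} [Fintype L] [DecidableEq L] {m : ℕ} {F : ℕ → ℝ} {Γ : ℝ} {c : ℕ → ℝ}

theorem greedyMatching_assignment (O : DiscreteOCS (Option L) m) {T : ℕ} (w : Fin T → L → ℝ≥0)
    (ω : O.Ω) (j : Fin T) :
    (greedyMatching F Γ c O).assignment w ω j
      = (O.winner (padded (greedyInput m F Γ c (extendByZero w))) (2 * j) ω).filter
          fun i => 0 < w j i := by
  have h : (fun s : Fin (2 * (j : ℕ) + 1) => padded (greedyInput m F Γ c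
        (extendByZero fun s : Fin ((j : ℕ) + 1) => w (s.castLE j.isLt))) s)
      = fun s : Fin (2 * (j : ℕ) + 1) => padded (greedyInput m F Γ c (extendByZero w)) s := by
    funext s
    rw [padded, padded, greedyInput_congr]
    intro τ hτ
    have h1 := s.isLt
    have h2 := j.isLt
    rw [extendByZero, extendByZero, dif_pos (by omega), dif_pos (by omega)]
    rfl
  rw [DiscreteOCS.winner, ← h]
  rfl

/-- The contribution of `i` to the total weight has expectation at least `primalVal`. -/
theorem primalVal_le_integral (hR : IsResidual m F Γ c) {O : DiscreteOCS (Option L) m}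
    (hO : O.HasParameter F) {T : ℕ} (w : Fin T → L → ℝ≥0) (i : L) {X : O.Ω → ℝ≥0}
    (hX : X = fun ω => (Finset.univ.filter fun j =>
      (greedyMatching F Γ c O).assignment w ω j = some i).sup fun j => w j i) :
    Integrable (fun ω => (X ω : ℝ)) O.μ ∧
      primalVal F (greedyState m F Γ c (extendByZero w) T i) ≤ ∫ ω, (X ω : ℝ) ∂O.μ := by
  let : MeasurableSpace (Option L) := ⊤
  have hmeas : Measurable fun ω => (X ω : ℝ) := by
    have h1 : Measurable ((greedyMatching F Γ c O).assignment w) := by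
      refine measurable_pi_iff.mpr fun j => measurable_to_countable' fun y => ?_
      exact (greedyMatching F Γ c O).measurable_act _ _ y
    have h2 : Measurable fun σ : Fin T → Option L =>
        (((Finset.univ.filter fun j => σ j = some i).sup fun j => w j i : ℝ≥0) : ℝ) :=
      measurable_of_countable _
    rw [hX]
    exact h2.comp h1
  have hle : ∀ ω, X ω ≤ Finset.univ.sup fun j => w j i := fun ω => by
    rw [hX]; exact Finset.sup_mono (Finset.filter_subset _ _)
  have hint : Integrable (fun ω => (X ω : ℝ)) O.μ :=
    Integrable.of_bound hmeas.aestronglyMeasurable ((Finset.univ.sup fun j => w j i : ℝ≥0) : ℝ)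
      (Filter.Eventually.of_forall fun ω => by simpa using hle ω)
  refine ⟨hint, ?_⟩
  rw [hint.integral_eq_integral_meas_le (Filter.Eventually.of_forall fun ω => (X ω).coe_nonneg)]
  have htail : IntegrableOn (fun x => O.μ.real {ω | x ≤ (X ω : ℝ)}) (Set.Ioi 0) := by
    refine integrableOn_Ioi_of_bounded (C := 1)
      (M := ((Finset.univ.sup fun j => w j i : ℝ≥0) : ℝ)) ?_ (fun x => ?_) (fun x hx => ?_)
    · refine Antitone.measurable fun x y hxy => measureReal_mono fun ω hω => ?_
      exact hxy.trans hω
    · rw [abs_of_nonneg measureReal_nonneg]; exact measureReal_le_one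
    · have : {ω | x ≤ (X ω : ℝ)} = ∅ := by
        refine Set.eq_empty_of_forall_notMem fun ω hω => ?_
        exact absurd (hx.trans_le hω) (not_lt.mpr (NNReal.coe_le_coe.mpr (hle ω)))
      rw [this, measureReal_empty]
  refine setIntegral_mono_on ((isRunProfile_greedyState hR _ T i).integrableOn_primalShare hR) htail
    measurableSet_Ioi fun x hx => ?_
  have hcompl := probReal_compl_eq_one_sub (μ := O.μ)
    (s := {ω | x ≤ (X ω : ℝ)}) (measurableSet_le measurable_const hmeas)
  have hOCS := measureReal_le_runState hR.F_zero hO (greedyInput m F Γ c (extendByZero w)) i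
    (fun τ => extendByZero w τ i) x T
  have hsub : {ω | x ≤ (X ω : ℝ)}ᶜ ⊆ {ω | ∀ t < T, x ≤ (extendByZero w t i : ℝ) →
      O.winner (padded (greedyInput m F Γ c (extendByZero w))) (2 * t) ω ≠ some i} := by
    intro ω hω t ht hxw hwin
    refine hω ?_
    have h1 : x ≤ w ⟨t, ht⟩ i := by
      rwa [← extendByZero_coe w ⟨t, ht⟩]
    have h2 : (greedyMatching F Γ c O).assignment w ω ⟨t, ht⟩ = some i := by
      rw [greedyMatching_assignment, Option.filter_eq_some_iff]
      exact ⟨hwin, by simpa using (show (0 : ℝ) < w ⟨t, ht⟩ i from lt_of_lt_of_le hx h1)⟩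
    refine h1.trans (NNReal.coe_le_coe.mpr ?_)
    rw [hX]
    exact Finset.le_sup (f := fun j => w j i)
      (Finset.mem_filter.mpr ⟨Finset.mem_univ _, h2⟩)
  have hmono := measureReal_mono (μ := O.μ) hsub
  rw [← greedyState_apply] at hOCS
  rw [primalShare]
  linarith

theorem isCompetitive_greedyMatching (hR : IsResidual m F Γ c) {O : DiscreteOCS (Option L) m}
    (hO : O.HasParameter F) : (greedyMatching F Γ c O).IsCompetitive Γ := by
  intro T w
  have hm : m ≠ 0 := ne_zero_of_discreteOCS O
  have hdual := mul_optimalWeight_le w (Γ := Γ)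
    (α := fun i => dualVar Γ c (greedyState m F Γ c (extendByZero w) T i))
    (β := fun j => onlineDual m F Γ c (extendByZero w) j)
    (dualVar_greedyState_nonneg hR _ T) (fun j => onlineDual_nonneg _ _)
    (fun i j => by
      have := dual_feasible hR hm (extendByZero w) j.isLt i
      rwa [extendByZero_coe] at this)
  rw [Fin.sum_univ_eq_sum_range (fun t => onlineDual m F Γ c (extendByZero w) t) T] at hdual
  refine hdual.trans ((sum_dual_le_sum_primalVal hR (extendByZero w) T).trans ?_)
  simp only [matchingWeight, NNReal.coe_sum]
  have hX := fun i => primalVal_le_integral hR hO w i rfl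
  refine (Finset.sum_le_sum fun i _ => (hX i).2).trans_eq ?_
  exact (integral_finsetSum _ fun i _ => (hX i).1).symm

end Competitive

theorem mainTheorem3 (m : ℕ) (F : ℕ → ℝ) (hF01 : ∀ k, F k ∈ Set.Icc (0 : ℝ) 1)
    (hconv : ConvexSeq F) (hlog : LogConcaveSeq F)
    (hlim : Filter.Tendsto F Filter.atTop (nhds 0))
    (hthird : ∀ k₁ k₂ : ℕ,
      (fwdDiff 1)^[3] F k₁ * fwdDiff 1 F k₂ + fwdDiff 1 F k₁ * (fwdDiff 1)^[3] F k₂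
        ≤ 2 * ((fwdDiff 1)^[2] F k₁ * (fwdDiff 1)^[2] F k₂))
    (Γ : ℝ) (hΓ : Γ = competitiveRatio m F)
    (hm : (m : ℝ) ≤ (-(m : ℝ) * fwdDiff 1 F 0 - Γ) / (Γ + (1 - Γ) * ((m : ℝ) * fwdDiff 1 F 0)))
    (hOCS : ∀ (L : Type) [Fintype L] [DecidableEq L], ∃ O : DiscreteOCS L m, O.HasParameter F) :
    ∀ (L : Type) [Fintype L] [DecidableEq L],
      ∃ B : OnlineMatchingAlgorithm L, B.IsCompetitive Γ := by
  intro L _ _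
  obtain ⟨O, hO⟩ := hOCS (Option L)
  obtain ⟨O', hO'⟩ := hOCS (Option Unit)
  have hF0 : F 0 = 1 := le_antisymm (hF01 0).2 (one_le_F_zero hO' ())
  exact ⟨greedyMatching F Γ (residualSeq m F) O, isCompetitive_greedyMatching
    (isResidual_residualSeq (ne_zero_of_discreteOCS O) hF01 hF0 hconv hlog hlim hthird hΓ hm) hO⟩
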